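/- A hypergraph $H=(V,E)$ consists of a finite vertex set $V$ and a set $E$ of subsets of $V$ (the hyperedges); it is $k$-uniform if every hyperedge has exactly $k$ elements, and its order is $|V|$. The distance $d_H(u,v)$ of two vertices is the least $\ell \ge 0$ for which there are vertices $u=x_0,x_1,\dots,x_\ell=v$ and hyperedges $e_1,\dots,e_\ell$ with $x_{i-1},x_i\in e_i$ for all $1\le i\le \ell$; it is $+\infty$ if no such $\ell$ exists. The total distance of $H$ is $W(H)=\sum_{\{u,v\}\subseteq V,\,u\neq v} d_H(u,v)$. For $v\in V$, the hypergraph $H\setminus v$ is obtained from $H$ by removing $v$ and all hyperedges containing $v$. A $k$-uniform hypergraph $H$ is a Šoltés hypergraph if it is connected (that is, $W(H)<+\infty$) and $W(H\setminus v)=W(H)$ for every $v\in V$. Proposition. Let $n$ and $k$ be integers with $2\le n\le 9$, $k\ge 0$ and $k\ge n-4$. Then there is no $k$-uniform Šoltés hypergraph of order $n$. -/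

import Mathlib

namespace Hypergraph

/-- Every hyperedge has exactly `k` vertices. -/
def IsUniform {α : Type*} (H : Hypergraph α) (k : ℕ) : Prop :=
  ∀ e ∈ H.edgeSet, e.encard = (k : ℕ∞)

/-- The hypergraph `H ∖ v`: the vertex `v` is removed, together with all hyperedges containing `v`
(so that a uniform hypergraph stays uniform). -/
def deleteVertex {α : Type*} (H : Hypergraph α) (v : α) : Hypergraph α where
  vertexSet := H.vertexSet \ {v}
  edgeSet := {e ∈ H.edgeSet | v ∉ e}
  subset_vertexSet_of_mem_edgeSet' := fun _ he _ hx =>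
    ⟨H.subset_vertexSet_of_mem_edgeSet' he.1 hx, fun hxv => he.2 (hxv ▸ hx)⟩

/-- There is a walk `x 0, e 0, x 1, e 1, …, e (l - 1), x l` with `l` hyperedges from `u` to `v`,
where consecutive vertices `x i, x (i + 1)` both belong to the hyperedge `e i`. -/
def HasWalk {α : Type*} (H : Hypergraph α) (u v : α) (l : ℕ) : Prop :=
  ∃ (x : ℕ → α) (e : ℕ → Set α), x 0 = u ∧ x l = v ∧
    ∀ i < l, e i ∈ H.edgeSet ∧ x i ∈ e i ∧ x (i + 1) ∈ e i

theorem HasWalk.symm {α : Type*} {H : Hypergraph α} {u v : α} {l : ℕ} (h : H.HasWalk u v l) :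
    H.HasWalk v u l := by
  obtain ⟨x, e, h0, hl, h⟩ := h
  refine ⟨fun i => x (l - i), fun i => e (l - (i + 1)), by simpa using hl, by simpa using h0, ?_⟩
  intro i hi
  obtain ⟨h1, h2, h3⟩ := h (l - (i + 1)) (by omega)
  have hli : l - (i + 1) + 1 = l - i := by omega
  rw [hli] at h3
  exact ⟨h1, h3, h2⟩

/-- The distance of `u` and `v`: the number of hyperedges of a shortest walk between them, and `⊤`
if there is none. -/
noncomputable def distance {α : Type*} (H : Hypergraph α) (u v : α) : ℕ∞ :=
  ⨅ (l : ℕ) (_ : H.HasWalk u v l), (l : ℕ∞)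

theorem distance_comm {α : Type*} (H : Hypergraph α) (u v : α) :
    H.distance u v = H.distance v u := by
  have h : ∀ l, H.HasWalk u v l ↔ H.HasWalk v u l := fun l => ⟨HasWalk.symm, HasWalk.symm⟩
  simp only [distance, h]

/-- The total distance (Wiener index) of a hypergraph with finitely many vertices: the sum of the
distances over all unordered pairs of distinct vertices. It is `⊤` if `H` is disconnected. -/
noncomputable def wienerIndex {α : Type*} (H : Hypergraph α) : ℕ∞ :=
  ∑ᶠ p ∈ {p : Sym2 α | ¬ p.IsDiag ∧ ∀ x ∈ p, x ∈ H.vertexSet},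
    Sym2.lift ⟨H.distance, H.distance_comm⟩ p

/-- Any two vertices are joined by a walk. -/
def IsConnected {α : Type*} (H : Hypergraph α) : Prop :=
  ∀ u ∈ H.vertexSet, ∀ v ∈ H.vertexSet, ∃ l, H.HasWalk u v l

/-- A Šoltés hypergraph: a finite connected hypergraph (so that its total distance is finite) whose
total distance does not change when any one of its vertices is removed. -/
def IsSoltes {α : Type*} (H : Hypergraph α) : Prop :=
  H.vertexSet.Finite ∧ H.IsConnected ∧
    ∀ v ∈ H.vertexSet, (H.deleteVertex v).wienerIndex = H.wienerIndex

end Hypergraph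

/-! Write `n` for the order and `W` for the total distance. All `W(H∖v) = W(H)` is finite, so every
`H∖v` is connected, and two edges around a distant pair bound its diameter by `D = max(2, n+2-2k)`
(`IsConnected.two_mul_add_natDist_le`). Two arguments share the cases.

Averaging, for `k = 2` and `(n,k) = (7,3), (8,4)`. Summing over `v` gives `∑ W(H∖v) = n·W(H)`. A
pair at distance `d` has a shortest walk on at most `d(k-1)+1` vertices, and only removing one of
these can lengthen the distance, to at most `D`. So the pair contributes at most `(n-2)d +
(d(k-1)-1)(D-d)` to the left side, against `nd` on the right. For `k = 2` this is strictly too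
small. In the other two cases equality forces a Steiner system (`IsSoltes.steiner`): on 8 points
with blocks of size 4 none exists, and on 7 points with blocks of size 3 the deleted distances are
too small.

Counting, for `n ≤ k+3` and `(9,5)`, with `k ≥ 3`. Here `D = 2`, so `H∖v` needs at least `n-1` pairs
lying in no common edge, while edges with complements of size `j = n-1-k` leave at most `j²` such
pairs. This excludes `j ≤ 2`. For `(9,5)` the near-equality `8 ≤ 9` forces each `H∖v` to have
exactly two edges, and counting non-incidences gives `18 = 4·|E|`. -/

namespace Hypergraph

section

open scoped Classical

variable {α : Type*} {H : Hypergraph α} {u v w y z : α} {e f : Set α} {e₀ : Finset α} {k l j D : ℕ}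
  {V U : Finset α} {E : Finset (Finset α)}

/-! ### Walks and distances -/

theorem HasWalk.refl (H : Hypergraph α) (u : α) : H.HasWalk u u 0 :=
  ⟨fun _ => u, fun _ => ∅, rfl, rfl, fun _ hi => absurd hi (Nat.not_lt_zero _)⟩

theorem HasWalk.snoc (h : H.HasWalk u y l) (he : e ∈ H.edgeSet) (hy : y ∈ e) (hz : z ∈ e) :
    H.HasWalk u z (l + 1) := by
  obtain ⟨x, f, h0, hl, h⟩ := h
  refine ⟨fun i => if i ≤ l then x i else z, fun i => if i < l then f i else e, by simp [h0],
    by simp, fun i hi => ?_⟩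
  rcases (Nat.lt_succ_iff_lt_or_eq.1 hi) with hi | rfl
  · have h1 : i ≤ l := hi.le
    have h2 : i + 1 ≤ l := hi
    simpa [hi, h1, h2] using h i hi
  · simpa [hl] using ⟨he, hy, hz⟩

theorem HasWalk.exists_last_edge (h : H.HasWalk u w l) (hl : 0 < l) :
    ∃ y, ∃ e ∈ H.edgeSet, H.HasWalk u y (l - 1) ∧ y ∈ e ∧ w ∈ e := by
  obtain ⟨x, f, h0, hw, h⟩ := h
  have := h (l - 1) (by omega)
  rw [Nat.sub_add_cancel hl, hw] at this
  exact ⟨x (l - 1), f (l - 1), this.1, ⟨x, f, h0, rfl, fun i hi => h i (by omega)⟩, this.2⟩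

theorem hasWalk_zero_iff : H.HasWalk u w 0 ↔ u = w := by
  refine ⟨fun ⟨x, _, h0, h1, _⟩ => h0.symm.trans h1, ?_⟩
  rintro rfl
  exact HasWalk.refl H u

theorem HasWalk.distance_le (h : H.HasWalk u w l) : H.distance u w ≤ l := iInf₂_le l h

theorem exists_hasWalk_of_distance_ne_top (h : H.distance u w ≠ ⊤) :
    ∃ l : ℕ, H.HasWalk u w l ∧ H.distance u w = l := by
  have hex : ∃ l, H.HasWalk u w l := by
    by_contra! hno
    exact h (by simp [distance, hno])
  exact ⟨Nat.find hex, Nat.find_spec hex, le_antisymm (Nat.find_spec hex).distance_le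
    (le_iInf₂ fun l hl => Nat.cast_le.2 (Nat.find_min' hex hl))⟩

/-- The distance as a natural number (`0` if there is no walk). -/
noncomputable def natDist (H : Hypergraph α) (u w : α) : ℕ := (H.distance u w).toNat

theorem HasWalk.natDist_le (h : H.HasWalk u w l) : H.natDist u w ≤ l :=
  ENat.toNat_le_of_le_natCast h.distance_le

theorem natDist_self (H : Hypergraph α) (u : α) : H.natDist u u = 0 :=
  Nat.le_zero.1 (HasWalk.refl H u).natDist_le

theorem IsConnected.distance_ne_top (hc : H.IsConnected) (hu : u ∈ H.vertexSet)
    (hw : w ∈ H.vertexSet) : H.distance u w ≠ ⊤ := by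
  obtain ⟨l, hl⟩ := hc u hu w hw
  exact ne_top_of_le_ne_top (ENat.natCast_ne_top l) hl.distance_le

theorem IsConnected.natCast_natDist (hc : H.IsConnected) (hu : u ∈ H.vertexSet)
    (hw : w ∈ H.vertexSet) : (H.natDist u w : ℕ∞) = H.distance u w :=
  ENat.natCast_toNat_eq_self.2 (hc.distance_ne_top hu hw)

theorem IsConnected.hasWalk_natDist (hc : H.IsConnected) (hu : u ∈ H.vertexSet)
    (hw : w ∈ H.vertexSet) : H.HasWalk u w (H.natDist u w) := by
  obtain ⟨l, hl, h⟩ := exists_hasWalk_of_distance_ne_top (hc.distance_ne_top hu hw)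
  rwa [natDist, h, ENat.toNat_natCast]

theorem IsConnected.natDist_pos (hc : H.IsConnected) (hu : u ∈ H.vertexSet)
    (hw : w ∈ H.vertexSet) (huw : u ≠ w) : 0 < H.natDist u w := by
  by_contra! h
  have := hc.hasWalk_natDist hu hw
  rw [Nat.le_zero.1 h, hasWalk_zero_iff] at this
  exact huw this

theorem natDist_le_one (he : e ∈ H.edgeSet) (hu : u ∈ e) (hw : w ∈ e) : H.natDist u w ≤ 1 :=
  ((HasWalk.refl H u).snoc he hu hw).natDist_le

theorem IsConnected.exists_edge_of_natDist_eq_one (hc : H.IsConnected) (hu : u ∈ H.vertexSet)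
    (hw : w ∈ H.vertexSet) (h : H.natDist u w = 1) : ∃ e ∈ H.edgeSet, u ∈ e ∧ w ∈ e := by
  have := hc.hasWalk_natDist hu hw
  rw [h] at this
  obtain ⟨y, e, he, hy, hye, hwe⟩ := this.exists_last_edge one_pos
  rw [Nat.sub_self, hasWalk_zero_iff] at hy
  exact ⟨e, he, hy ▸ hye, hwe⟩

theorem IsConnected.exists_edge_mem (hc : H.IsConnected) (hu : u ∈ H.vertexSet)
    (hw : w ∈ H.vertexSet) (huw : u ≠ w) : ∃ e ∈ H.edgeSet, w ∈ e := by
  obtain ⟨_, e, he, -, -, hwe⟩ :=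
    (hc.hasWalk_natDist hu hw).exists_last_edge (hc.natDist_pos hu hw huw)
  exact ⟨e, he, hwe⟩

theorem IsConnected.natDist_le_succ (hc : H.IsConnected) (hu : u ∈ H.vertexSet)
    (he : e ∈ H.edgeSet) (hy : y ∈ e) (hz : z ∈ e) : H.natDist u z ≤ H.natDist u y + 1 :=
  ((hc.hasWalk_natDist hu (H.subset_vertexSet_of_mem_edgeSet' he hy)).snoc he hy hz).natDist_le

theorem IsConnected.exists_natDist_eq (hc : H.IsConnected) (hu : u ∈ H.vertexSet)
    (hw : w ∈ H.vertexSet) {i : ℕ} (hi : i ≤ H.natDist u w) :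
    ∃ y ∈ H.vertexSet, H.natDist u y = i := by
  obtain ⟨j, hj⟩ := Nat.exists_eq_add_of_le hi
  induction j generalizing w with
  | zero => exact ⟨w, hw, hj⟩
  | succ j ih =>
    obtain ⟨y, e, he, hy, hye, hwe⟩ := (hc.hasWalk_natDist hu hw).exists_last_edge (by omega)
    have h1 := hc.natDist_le_succ hu he hye hwe
    have h2 := hy.natDist_le
    exact ih (H.subset_vertexSet_of_mem_edgeSet' he hye) (by omega) (by omega)

theorem IsUniform.ncard (hk : H.IsUniform k) (he : e ∈ H.edgeSet) : e.ncard = k := by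
  rw [Set.ncard, hk e he, ENat.toNat_natCast]

/-- Two edges far apart and the levels between them bound the diameter. -/
theorem IsConnected.two_mul_add_natDist_le (hc : H.IsConnected) (hk : H.IsUniform k)
    (hV : (V : Set α) = H.vertexSet) (hu : u ∈ V) (hw : w ∈ V) (hd : 3 ≤ H.natDist u w) :
    2 * k + H.natDist u w ≤ V.card + 3 := by
  have hmem : ∀ a, a ∈ V ↔ a ∈ H.vertexSet := fun a => by rw [← hV, Finset.mem_coe]
  rw [hmem] at hu hw
  set d := H.natDist u w with hd'
  have huw : u ≠ w := by
    rintro rfl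
    rw [natDist_self] at hd'
    omega
  obtain ⟨e, he, hue⟩ := hc.exists_edge_mem hw hu huw.symm
  obtain ⟨f, hf, hwf⟩ := hc.exists_edge_mem hu hw huw
  have hsub : ∀ {g : Set α} {S : Finset α}, g ∈ H.edgeSet → (∀ a ∈ g, a ∈ S) → k ≤ S.card := by
    intro g S hg hS
    rw [← hk.ncard hg, ← Set.ncard_coe_finset S]
    exact Set.ncard_le_ncard hS S.finite_toSet
  have h1 : k ≤ (V.filter fun a => H.natDist u a ≤ 1).card := hsub he fun a ha =>
    Finset.mem_filter.2 ⟨(hmem a).2 (H.subset_vertexSet_of_mem_edgeSet' he ha),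
      natDist_le_one he hue ha⟩
  have h2 : k ≤ (V.filter fun a => d - 1 ≤ H.natDist u a).card := hsub hf fun a ha =>
    Finset.mem_filter.2 ⟨(hmem a).2 (H.subset_vertexSet_of_mem_edgeSet' hf ha), by
      have := hc.natDist_le_succ hu hf ha hwf
      omega⟩
  -- A shortest walk meets every level, so each of the levels `2, …, d - 2` is nonempty.
  have h3 : d - 3 ≤ (V.filter fun a => 2 ≤ H.natDist u a ∧ H.natDist u a ≤ d - 2).card := by
    have : Finset.Icc 2 (d - 2) ⊆
        (V.filter fun a => 2 ≤ H.natDist u a ∧ H.natDist u a ≤ d - 2).image (H.natDist u) := by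
      intro i hi
      rw [Finset.mem_Icc] at hi
      obtain ⟨y, hy, rfl⟩ := hc.exists_natDist_eq hu hw (i := i) (by omega)
      exact Finset.mem_image.2 ⟨y, Finset.mem_filter.2 ⟨(hmem y).2 hy, hi⟩, rfl⟩
    have h := (Finset.card_le_card this).trans Finset.card_image_le
    rw [Nat.card_Icc] at h
    omega
  have hdis1 : Disjoint (V.filter fun a => H.natDist u a ≤ 1)
      (V.filter fun a => 2 ≤ H.natDist u a ∧ H.natDist u a ≤ d - 2) :=
    Finset.disjoint_filter.2 fun a _ => by omega
  have hdis2 : Disjoint ((V.filter fun a => H.natDist u a ≤ 1) ∪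
      (V.filter fun a => 2 ≤ H.natDist u a ∧ H.natDist u a ≤ d - 2))
      (V.filter fun a => d - 1 ≤ H.natDist u a) := by
    rw [← Finset.filter_or]
    exact Finset.disjoint_filter.2 fun a _ => by omega
  have h := Finset.card_le_card (Finset.union_subset (Finset.union_subset
    (Finset.filter_subset (fun a => H.natDist u a ≤ 1) V)
    (Finset.filter_subset (fun a => 2 ≤ H.natDist u a ∧ H.natDist u a ≤ d - 2) V))
    (Finset.filter_subset (fun a => d - 1 ≤ H.natDist u a) V))
  rw [Finset.card_union_of_disjoint hdis2, Finset.card_union_of_disjoint hdis1] at h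
  omega

/-! ### The total distance as a sum over ordered pairs -/

theorem two_mul_wienerIndex (hV : (V : Set α) = H.vertexSet) :
    2 * H.wienerIndex = ∑ u ∈ V, ∑ w ∈ V, H.distance u w := by
  -- An arbitrary linear order picks one orientation of each unordered pair.
  let := linearOrderOfSTO (WellOrderingRel (α := α))
  have h1 : H.wienerIndex =
      ∑ p ∈ V.sym2 with ¬ p.IsDiag, Sym2.lift ⟨H.distance, H.distance_comm⟩ p := by
    rw [wienerIndex, finsum_mem_eq_finite_toFinset_sum]
    rotate_left
    · exact (V.sym2.filter fun p => ¬ p.IsDiag).finite_toSet.subset fun p hp => by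
        simp only [Finset.coe_filter, Finset.mem_sym2_iff, Set.mem_ofPred_eq] at hp ⊢
        exact ⟨fun a ha => by rw [← Finset.mem_coe, hV]; exact hp.2 a ha, hp.1⟩
    refine Finset.sum_congr ?_ fun _ _ => rfl
    ext p
    simp only [Set.Finite.mem_toFinset, Set.mem_ofPred_eq, Finset.mem_filter, Finset.mem_sym2_iff,
      ← hV, Finset.mem_coe, and_comm]
  have h2 : ∑ u ∈ V, ∑ w ∈ V, H.distance u w = ∑ p ∈ V.offDiag, H.distance p.1 p.2 := by
    rw [← Finset.sum_product']
    symm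
    refine Finset.sum_subset (fun p hp => ?_) fun p hp hp' => ?_
    · simp only [Finset.mem_product, Finset.mem_offDiag] at hp ⊢
      exact ⟨hp.1, hp.2.1⟩
    · simp only [Finset.mem_product, Finset.mem_offDiag, not_and, not_not] at hp hp'
      rw [hp' hp.1 hp.2]
      exact le_antisymm (HasWalk.refl H p.2).distance_le zero_le
  rw [h1, Finset.sum_sym2_filter_not_isDiag, h2, two_mul,
    ← Finset.sum_filter_add_sum_filter_not V.offDiag (fun p => p.1 < p.2)]
  congr 1
  refine Finset.sum_bij' (fun p _ => p.swap) (fun p _ => p.swap) ?_ ?_ ?_ ?_ ?_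
  · simp only [Finset.mem_filter, Finset.mem_offDiag, Prod.fst_swap, Prod.snd_swap, not_lt]
    exact fun p hp => ⟨⟨hp.1.2.1, hp.1.1, hp.1.2.2.symm⟩, hp.2.le⟩
  · simp only [Finset.mem_filter, Finset.mem_offDiag, Prod.fst_swap, Prod.snd_swap, not_lt]
    exact fun p hp => ⟨⟨hp.1.2.1, hp.1.1, hp.1.2.2.symm⟩, lt_of_le_of_ne hp.2 hp.1.2.2.symm⟩
  · simp
  · simp
  · intro p _
    simp [H.distance_comm]

/-- A hypergraph with finite total distance is connected. -/
theorem isConnected_of_wienerIndex_ne_top (hV : (V : Set α) = H.vertexSet)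
    (h : H.wienerIndex ≠ ⊤) : H.IsConnected := by
  have h2 : ∑ u ∈ V, ∑ w ∈ V, H.distance u w ≠ ⊤ := by
    rw [← two_mul_wienerIndex hV]
    exact WithTop.mul_ne_top (by decide) h
  intro u hu w hw
  rw [← hV, Finset.mem_coe] at hu hw
  obtain ⟨l, hl, -⟩ := exists_hasWalk_of_distance_ne_top
    (WithTop.sum_ne_top.1 (WithTop.sum_ne_top.1 h2 u hu) w hw)
  exact ⟨l, hl⟩

theorem IsConnected.two_mul_wienerIndex (hc : H.IsConnected) (hV : (V : Set α) = H.vertexSet) :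
    2 * H.wienerIndex = ((∑ u ∈ V, ∑ w ∈ V, H.natDist u w : ℕ) : ℕ∞) := by
  rw [Hypergraph.two_mul_wienerIndex hV]
  push_cast
  refine Finset.sum_congr rfl fun u hu => Finset.sum_congr rfl fun w hw => ?_
  rw [hc.natCast_natDist (hV ▸ hu) (hV ▸ hw)]

theorem coe_erase_eq_vertexSet (hV : (V : Set α) = H.vertexSet) (v : α) :
    ((V.erase v : Finset α) : Set α) = (H.deleteVertex v).vertexSet := by
  rw [Finset.coe_erase, hV]
  rfl

theorem IsUniform.deleteVertex (hk : H.IsUniform k) (v : α) : (H.deleteVertex v).IsUniform k :=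
  fun e he => hk e he.1

theorem IsSoltes.isConnected_deleteVertex (hs : H.IsSoltes) (hV : (V : Set α) = H.vertexSet)
    (hv : v ∈ V) : (H.deleteVertex v).IsConnected := by
  refine isConnected_of_wienerIndex_ne_top (coe_erase_eq_vertexSet hV v) ?_
  rw [hs.2.2 v (hV ▸ hv)]
  intro h
  have := hs.2.1.two_mul_wienerIndex hV
  rw [h] at this
  exact ENat.natCast_ne_top _ this.symm

theorem IsSoltes.sum_natDist_deleteVertex (hs : H.IsSoltes) (hV : (V : Set α) = H.vertexSet)
    (hv : v ∈ V) : ∑ u ∈ V.erase v, ∑ w ∈ V.erase v, (H.deleteVertex v).natDist u w =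
      ∑ u ∈ V, ∑ w ∈ V, H.natDist u w := by
  have h1 := (hs.isConnected_deleteVertex hV hv).two_mul_wienerIndex (coe_erase_eq_vertexSet hV v)
  rw [hs.2.2 v (hV ▸ hv), hs.2.1.two_mul_wienerIndex hV] at h1
  exact_mod_cast h1.symm

/-! ### Averaging over the removed vertex -/

theorem IsUniform.finite (hk : H.IsUniform k) (he : e ∈ H.edgeSet) : e.Finite :=
  Set.finite_of_encard_eq_coe (hk e he)

/-- The vertices covered by the edges of a walk of length `l`, outside of which vertices may be
removed without destroying the walk. -/
theorem HasWalk.exists_support (hk : H.IsUniform k) (h : H.HasWalk u w l) :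
    ∃ U : Finset α, u ∈ U ∧ w ∈ U ∧ U.card ≤ l * (k - 1) + 1 ∧
      ∀ v ∉ U, (H.deleteVertex v).HasWalk u w l := by
  induction l generalizing w with
  | zero =>
    obtain rfl := hasWalk_zero_iff.1 h
    exact ⟨{u}, by simp, by simp, by simp, fun v _ => HasWalk.refl _ u⟩
  | succ l ih =>
    obtain ⟨y, e, he, hy, hye, hwe⟩ := h.exists_last_edge l.succ_pos
    obtain ⟨U, hu, hyU, hcard, hU⟩ := ih hy
    have hfin := hk.finite he
    have hecard : hfin.toFinset.card = k := by
      rw [← Set.ncard_eq_toFinset_card e hfin, hk.ncard he]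
    refine ⟨U ∪ hfin.toFinset, by simp [hu], by simp [hwe], ?_, fun v hv => ?_⟩
    -- The new edge meets `U` in `y`, so it adds at most `k - 1` vertices.
    · have h1 := Finset.card_union_add_card_inter U hfin.toFinset
      have h2 : 0 < (U ∩ hfin.toFinset).card := Finset.card_pos.2 ⟨y, by simp [hyU, hye]⟩
      have h3 : 0 < hfin.toFinset.card := Finset.card_pos.2 ⟨y, by simp [hye]⟩
      have h4 : (l + 1) * (k - 1) = l * (k - 1) + (k - 1) := Nat.succ_mul _ _
      omega
    · simp only [Finset.mem_union, Set.Finite.mem_toFinset, not_or] at hv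
      exact (hU v hv.1).snoc ⟨he, hv.2⟩ hye hwe

/-- The sum of the distances of `u` and `w` after removal of a third vertex. -/
noncomputable def removalSum (H : Hypergraph α) (V : Finset α) (u w : α) : ℕ :=
  ∑ v ∈ (V.erase u).erase w, (H.deleteVertex v).natDist u w

/-- Each removal costs `d`, and those in `U` other than `u` and `w` at most `D - d` more. The
truncated difference is harmless: for `D < d` the bound `d` holds anyway. -/
theorem removalSum_le {d : ℕ} (hu : u ∈ V) (hw : w ∈ V) (huw : u ≠ w) (huU : u ∈ U) (hwU : w ∈ U)
    (hD : ∀ v ∈ V, v ≠ u → v ≠ w → (H.deleteVertex v).natDist u w ≤ D)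
    (hU : ∀ v ∉ U, (H.deleteVertex v).natDist u w ≤ d) :
    H.removalSum V u w ≤ (V.card - 2) * d + (U.card - 2) * (D - d) := by
  have hcard : ∀ S : Finset α, u ∈ S → w ∈ S → ((S.erase u).erase w).card = S.card - 2 := by
    intro S hu hw
    rw [Finset.card_erase_of_mem (Finset.mem_erase.2 ⟨huw.symm, hw⟩), Finset.card_erase_of_mem hu]
    omega
  calc H.removalSum V u w
      ≤ ∑ v ∈ (V.erase u).erase w, (d + if v ∈ U then D - d else 0) := by
        refine Finset.sum_le_sum fun _ hv => ?_
        simp only [Finset.mem_erase] at hv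
        have h1 := hD _ hv.2.2 hv.2.1 hv.1
        split_ifs with hvU
        · omega
        · exact hU _ hvU
    _ = (V.card - 2) * d + (((V.erase u).erase w).filter (· ∈ U)).card * (D - d) := by
        rw [Finset.sum_add_distrib, Finset.sum_const, hcard V hu hw, smul_eq_mul,
          ← Finset.sum_filter, Finset.sum_const, smul_eq_mul]
    _ ≤ _ := by
        refine Nat.add_le_add_left (Nat.mul_le_mul_right _ ?_) _
        rw [← hcard U huU hwU]
        refine Finset.card_le_card fun _ hv => ?_
        simp only [Finset.mem_filter, Finset.mem_erase] at hv ⊢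
        exact ⟨hv.1.1, hv.1.2.1, hv.2⟩

theorem removalSum_self (H : Hypergraph α) (V : Finset α) (u : α) : H.removalSum V u u = 0 :=
  Finset.sum_eq_zero fun _ _ => natDist_self _ u

/-- Double counting of triples `(v, u, w)`: the removed vertex is summed first or last. -/
theorem IsSoltes.sum_removalSum (hs : H.IsSoltes) (hV : (V : Set α) = H.vertexSet) :
    ∑ u ∈ V, ∑ w ∈ V, H.removalSum V u w = ∑ u ∈ V, ∑ w ∈ V, V.card * H.natDist u w := by
  simp_rw [← Finset.mul_sum]
  rw [← smul_eq_mul, ← Finset.sum_const,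
    ← Finset.sum_congr rfl fun v hv => hs.sum_natDist_deleteVertex hV hv]
  symm
  rw [Finset.sum_comm' (t' := V) (s' := fun u => V.erase u)
    (by intro x y; simp only [Finset.mem_erase]; tauto)]
  refine Finset.sum_congr rfl fun u hu => ?_
  rw [Finset.sum_comm' (t' := V) (s' := fun w => (V.erase u).erase w)
    (by intro x y; simp only [Finset.mem_erase]; tauto)]
  rfl

theorem IsSoltes.removalSum_eq (hs : H.IsSoltes) (hV : (V : Set α) = H.vertexSet)
    (h : ∀ u ∈ V, ∀ w ∈ V, u ≠ w → H.removalSum V u w ≤ V.card * H.natDist u w)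
    (hu : u ∈ V) (hw : w ∈ V) : H.removalSum V u w = V.card * H.natDist u w := by
  have h' : ∀ u ∈ V, ∀ w ∈ V, H.removalSum V u w ≤ V.card * H.natDist u w := by
    intro u hu w hw
    rcases eq_or_ne u w with rfl | huw
    · rw [removalSum_self]
      exact Nat.zero_le _
    · exact h u hu w hw huw
  have h1 := (Finset.sum_eq_sum_iff_of_le fun u hu => Finset.sum_le_sum (h' u hu)).1
    (hs.sum_removalSum hV) u hu
  exact (Finset.sum_eq_sum_iff_of_le (h' u hu)).1 h1 w hw

theorem IsSoltes.natDist_deleteVertex_le (hs : H.IsSoltes) (hk : H.IsUniform k)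
    (hV : (V : Set α) = H.vertexSet) (hv : v ∈ V) (hu : u ∈ V.erase v) (hw : w ∈ V.erase v) :
    (H.deleteVertex v).natDist u w ≤ max 2 (V.card + 2 - 2 * k) := by
  by_contra! h
  have h3 : 3 ≤ (H.deleteVertex v).natDist u w := (le_max_left _ _).trans_lt h
  have h1 := (hs.isConnected_deleteVertex hV hv).two_mul_add_natDist_le (hk.deleteVertex v)
    (coe_erase_eq_vertexSet hV v) hu hw h3
  have h2 := (le_max_right _ _).trans_lt h
  rw [Finset.card_erase_of_mem hv] at h1
  have := Finset.card_pos.2 ⟨v, hv⟩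
  omega

theorem IsSoltes.removalSum_le (hs : H.IsSoltes) (hk : H.IsUniform k)
    (hV : (V : Set α) = H.vertexSet) (hu : u ∈ V) (hw : w ∈ V) (huw : u ≠ w) :
    H.removalSum V u w ≤ (V.card - 2) * H.natDist u w +
      (H.natDist u w * (k - 1) - 1) * (max 2 (V.card + 2 - 2 * k) - H.natDist u w) := by
  obtain ⟨U, huU, hwU, hcard, hU⟩ :=
    (hs.2.1.hasWalk_natDist (u := u) (w := w) (by rwa [← hV]) (by rwa [← hV])).exists_support hk
  refine (Hypergraph.removalSum_le hu hw huw huU hwU (D := max 2 (V.card + 2 - 2 * k))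
    (fun v hv hvu hvw => hs.natDist_deleteVertex_le hk hV hv
      (Finset.mem_erase.2 ⟨hvu.symm, hu⟩) (Finset.mem_erase.2 ⟨hvw.symm, hw⟩))
    (fun v hv => (hU v hv).natDist_le)).trans ?_
  exact Nat.add_le_add_left (Nat.mul_le_mul_right _ (by omega)) _

/-- There is no Šoltés graph with at most six vertices. -/
theorem IsSoltes.not_isUniform_two (hs : H.IsSoltes) (hV : (V : Set α) = H.vertexSet)
    (h2 : 2 ≤ V.card) (h6 : V.card ≤ 6) : ¬ H.IsUniform 2 := by
  intro hk
  have key : ∀ u ∈ V, ∀ w ∈ V, u ≠ w → H.removalSum V u w < V.card * H.natDist u w := by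
    intro u hu w hw huw
    have hd := hs.2.1.natDist_pos (hV ▸ hu) (hV ▸ hw) huw
    refine (hs.removalSum_le hk hV hu hw huw).trans_lt ?_
    obtain ⟨m, hm⟩ := Nat.exists_eq_add_of_le' h2
    generalize H.natDist u w = d at hd ⊢
    have hmax : max 2 (V.card + 2 - 2 * 2) ≤ 4 := by omega
    -- The excess over `(n-2)d` must stay below `2d`; with `D ≤ 4` this is `(d-1)(4-d) < 2d`.
    have : (d * (2 - 1) - 1) * (max 2 (V.card + 2 - 2 * 2) - d) < 2 * d := by
      refine (Nat.mul_le_mul_left _ (Nat.sub_le_sub_right hmax d)).trans_lt ?_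
      rcases Nat.lt_or_ge d 4 with h | h
      · interval_cases d <;> simp
      · rw [Nat.sub_eq_zero_of_le h]
        omega
    rw [hm, Nat.add_sub_cancel, Nat.add_mul]
    rw [hm] at this
    omega
  obtain ⟨u, hu, w, hw, huw⟩ := Finset.one_lt_card.1 h2
  exact (key u hu w hw huw).ne
    (hs.removalSum_eq hV (fun a ha b hb hab => (key a ha b hb hab).le) hu hw)

/-- In the two extremal cases of the averaging argument the hypergraph is a Steiner system. -/
theorem IsSoltes.steiner (hs : H.IsSoltes) (hk : H.IsUniform k) (hV : (V : Set α) = H.vertexSet)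
    (h : V.card = 7 ∧ k = 3 ∨ V.card = 8 ∧ k = 4) (hu : u ∈ V) (hw : w ∈ V) (huw : u ≠ w) :
    H.removalSum V u w = V.card ∧ ∃! e, e ∈ H.edgeSet ∧ u ∈ e ∧ w ∈ e := by
  have key : ∀ u ∈ V, ∀ w ∈ V, u ≠ w → H.removalSum V u w ≤ V.card * H.natDist u w ∧
      (H.natDist u w ≠ 1 → H.removalSum V u w < V.card * H.natDist u w) := by
    intro u hu w hw huw
    have hd := hs.2.1.natDist_pos (hV ▸ hu) (hV ▸ hw) huw
    have hle := hs.removalSum_le hk hV hu hw huw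
    generalize H.natDist u w = d at hd hle ⊢
    rcases h with ⟨h, rfl⟩ | ⟨h, rfl⟩
    -- Here `D = 3`, and `(2d-1)(3-d) ≤ 2d` with equality only at `d = 1`.
    · rw [h] at hle ⊢
      rcases Nat.lt_or_ge d 3 with hd3 | hd3
      · interval_cases d <;> simp at hle ⊢ <;> omega
      · rw [show max 2 (7 + 2 - 2 * 3) = 3 from rfl, Nat.sub_eq_zero_of_le hd3] at hle
        omega
    -- Here `D = 2`, and `(3d-1)(2-d) ≤ 2d` with equality only at `d = 1`.
    · rw [h] at hle ⊢
      rcases Nat.lt_or_ge d 2 with hd3 | hd3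
      · interval_cases d
        simp at hle ⊢
        omega
      · rw [show max 2 (8 + 2 - 2 * 4) = 2 from rfl, Nat.sub_eq_zero_of_le hd3] at hle
        omega
  have heq := hs.removalSum_eq hV (fun a ha b hb hab => (key a ha b hb hab).1) hu hw
  have hone : H.natDist u w = 1 := by
    by_contra hne
    exact ((key u hu w hw huw).2 hne).ne heq
  rw [hone, mul_one] at heq
  obtain ⟨e, he, hue, hwe⟩ := hs.2.1.exists_edge_of_natDist_eq_one (hV ▸ hu) (hV ▸ hw) hone
  refine ⟨heq, e, ⟨he, hue, hwe⟩, fun f ⟨hf, huf, hwf⟩ => ?_⟩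
  by_contra hne
  -- With two edges through `u` and `w`, only vertices of `e ∩ f` can destroy adjacency. There are
  -- fewer than `k` of them, so equality fails.
  have hle := Hypergraph.removalSum_le (H := H) (U := (hk.finite he).toFinset ∩ (hk.finite hf).toFinset)
    (d := 1) (D := max 2 (V.card + 2 - 2 * k)) hu hw huw (by simp [hue, huf]) (by simp [hwe, hwf])
    (fun v hv hvu hvw => hs.natDist_deleteVertex_le hk hV hv
      (Finset.mem_erase.2 ⟨hvu.symm, hu⟩) (Finset.mem_erase.2 ⟨hvw.symm, hw⟩))
    (fun v hv => by
      simp only [Finset.mem_inter, Set.Finite.mem_toFinset, not_and_or] at hv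
      rcases hv with hv | hv
      · exact natDist_le_one ⟨he, hv⟩ hue hwe
      · exact natDist_le_one ⟨hf, hv⟩ huf hwf)
  have hcard : ((hk.finite he).toFinset ∩ (hk.finite hf).toFinset).card < k := by
    refine lt_of_lt_of_eq ?_
      ((Set.ncard_eq_toFinset_card e (hk.finite he)).symm.trans (hk.ncard he))
    refine Finset.card_lt_card (Finset.ssubset_iff_subset_ne.2 ⟨Finset.inter_subset_left, ?_⟩)
    intro h'
    have hsub : e ⊆ f := fun a ha => by
      have : a ∈ (hk.finite he).toFinset ∩ (hk.finite hf).toFinset := by rw [h']; simpa using ha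
      simpa using (Finset.mem_inter.1 this).2
    exact hne (Set.eq_of_subset_of_ncard_le hsub (by rw [hk.ncard he, hk.ncard hf])
      (hk.finite hf)).symm
  rw [heq] at hle
  generalize ((hk.finite he).toFinset ∩ (hk.finite hf).toFinset).card = c at hle hcard
  rcases h with ⟨h, rfl⟩ | ⟨h, rfl⟩ <;> rw [h] at hle <;> simp at hle <;> omega

theorem IsSoltes.not_seven_three (hs : H.IsSoltes) (hk : H.IsUniform 3)
    (hV : (V : Set α) = H.vertexSet) : V.card ≠ 7 := by
  intro h7
  have hst := fun {u w} => hs.steiner (u := u) (w := w) hk hV (Or.inl ⟨h7, rfl⟩)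
  obtain ⟨u, hu, w, hw, huw⟩ := Finset.one_lt_card.1 (show 1 < V.card by omega)
  obtain ⟨hsum, e, ⟨he, hue, hwe⟩, huniq⟩ := hst hu hw huw
  have hfin := hk.finite he
  have hecard : hfin.toFinset.card = 3 := by
    rw [← Set.ncard_eq_toFinset_card e hfin, hk.ncard he]
  -- In the Steiner system the general bound 3 on deleted distances improves to 2, giving `7 ≤ 5 +
  -- 1`.
  have hle := Hypergraph.removalSum_le (H := H) (U := hfin.toFinset) (d := 1) (D := 2) hu hw huw
    (by simpa) (by simpa) (fun v hv hvu hvw => ?_)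
    (fun v hv => natDist_le_one ⟨he, by simpa using hv⟩ hue hwe)
  · rw [hsum, hecard, h7] at hle
    omega
  obtain ⟨y, hyV, hy⟩ : ∃ y ∈ V, y ∉ insert v hfin.toFinset := by
    refine Finset.exists_mem_notMem_of_card_lt_card ?_
    have := Finset.card_insert_le v hfin.toFinset
    omega
  simp only [Finset.mem_insert, Set.Finite.mem_toFinset, not_or] at hy
  have hyu : y ≠ u := fun h => hy.2 (h ▸ hue)
  have hyw : y ≠ w := fun h => hy.2 (h ▸ hwe)
  by_cases hve : v ∈ e
  -- An edge through `x` and `y` avoids `v`: one containing `x` and `v` would be `e`, but `y ∉ e`.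
  -- So `u` and `w` are joined through `y`.
  · have havoid : ∀ x ∈ V, x ∈ e → x ≠ v → ∃ f ∈ (H.deleteVertex v).edgeSet, x ∈ f ∧ y ∈ f := by
      intro x hx hxe hxv
      obtain ⟨-, f, ⟨hf, hxf, hyf⟩, -⟩ := hst hx hyV fun h => hy.2 (h ▸ hxe)
      refine ⟨f, ⟨hf, fun hvf => hy.2 ?_⟩, hxf, hyf⟩
      rwa [(hst hx hv hxv).2.unique ⟨he, hxe, hve⟩ ⟨hf, hxf, hvf⟩]
    obtain ⟨f, hf, huf, hyf⟩ := havoid u hu hue hvu.symm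
    obtain ⟨g, hg, hwg, hyg⟩ := havoid w hw hwe hvw.symm
    exact (((HasWalk.refl _ u).snoc hf huf hyf).snoc hg hyg hwg).natDist_le
  · exact (natDist_le_one (show e ∈ (H.deleteVertex v).edgeSet from ⟨he, hve⟩) hue hwe).trans
      one_le_two

theorem IsSoltes.not_eight_four (hs : H.IsSoltes) (hk : H.IsUniform 4)
    (hV : (V : Set α) = H.vertexSet) : V.card ≠ 8 := by
  intro h8
  have hst := fun {u w} => hs.steiner (u := u) (w := w) hk hV (Or.inr ⟨h8, rfl⟩)
  obtain ⟨u, hu⟩ := Finset.card_pos.1 (show 0 < V.card by omega)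
  have hsubV : ∀ {e}, e ∈ H.edgeSet → e ⊆ V := fun he => by
    rw [hV]
    exact H.subset_vertexSet_of_mem_edgeSet' he
  let E : Finset (Finset α) := V.powerset.filter fun e => (e : Set α) ∈ H.edgeSet ∧ u ∈ e
  have hmemE : ∀ e, e ∈ E ↔ (e : Set α) ∈ H.edgeSet ∧ u ∈ e := fun e => by
    simp only [E, Finset.mem_filter, Finset.mem_powerset, and_iff_right_iff_imp, and_imp]
    exact fun he _ => Finset.coe_subset.1 (hsubV he)
  have hun : E.biUnion (fun e => e.erase u) = V.erase u := by
    ext w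
    simp only [Finset.mem_biUnion, Finset.mem_erase]
    constructor
    · rintro ⟨e, he, hwu, hwe⟩
      exact ⟨hwu, hsubV ((hmemE e).1 he).1 hwe⟩
    · rintro ⟨hwu, hw⟩
      obtain ⟨-, e, ⟨he, hue, hwe⟩, -⟩ := hst hu hw hwu.symm
      exact ⟨(hk.finite he).toFinset, (hmemE _).2 (by simpa using ⟨he, hue⟩), hwu, by simpa⟩
  -- The edges through `u` partition the other 7 vertices into triples, but 3 does not divide 7.
  have hcard : (V.erase u).card = ∑ e ∈ E, 3 := by
    rw [← hun, Finset.card_biUnion]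
    · refine Finset.sum_congr rfl fun e he => ?_
      rw [hmemE] at he
      rw [Finset.card_erase_of_mem he.2, ← Set.ncard_coe_finset, hk.ncard he.1]
    · intro e he f hf hef
      rw [Finset.mem_coe, hmemE] at he hf
      refine Finset.disjoint_left.2 fun w hwe hwf => hef ?_
      rw [Finset.mem_erase] at hwe hwf
      exact Finset.coe_injective ((hst hu (hsubV he.1 hwe.2) hwe.1.symm).2.unique
        ⟨he.1, he.2, hwe.2⟩ ⟨hf.1, hf.2, hwf.2⟩)
  rw [Finset.card_erase_of_mem hu, h8, Finset.sum_const, smul_eq_mul] at hcard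
  omega

/-! ### Uncovered pairs -/

/-- The ordered pairs of distinct vertices which are not contained in a common edge. -/
noncomputable def uncovered (V : Finset α) (E : Finset (Finset α)) : Finset (α × α) :=
  V.offDiag.filter fun p => ∀ e ∈ E, p.1 ∈ e → p.2 ∉ e

theorem mem_uncovered {p : α × α} : p ∈ uncovered V E ↔
    (p.1 ∈ V ∧ p.2 ∈ V ∧ p.1 ≠ p.2) ∧ ∀ e ∈ E, p.1 ∈ e → p.2 ∉ e := by
  rw [uncovered, Finset.mem_filter, Finset.mem_offDiag]

/-- Every uncovered pair meets the complement of the edge `e₀`. -/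
theorem card_uncovered_le (he₀ : e₀ ∈ E) (N : α → Finset α)
    (hN : ∀ p ∈ uncovered V E, p.1 ∈ V \ e₀ → p.2 ∈ N p.1) :
    (uncovered V E).card ≤ ∑ a ∈ V \ e₀, ((N a).card + (N a \ (V \ e₀)).card) := by
  -- Pairs starting in `e₀` are counted reversed. Removing `V \ e₀` from `N a` there avoids counting
  -- twice the pairs with both ends outside `e₀`.
  have hsub : uncovered V E ⊆
      ((V \ e₀).sigma N).image (fun x => (x.1, x.2)) ∪
        ((V \ e₀).sigma fun a => N a \ (V \ e₀)).image (fun x => (x.2, x.1)) := by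
    intro p hp
    have hp' := mem_uncovered.1 hp
    by_cases h : p.1 ∈ V \ e₀
    · exact Finset.mem_union_left _ (Finset.mem_image.2
        ⟨⟨p.1, p.2⟩, Finset.mem_sigma.2 ⟨h, hN p hp h⟩, rfl⟩)
    · have h1 : p.1 ∈ e₀ := by
        by_contra h1
        exact h (Finset.mem_sdiff.2 ⟨hp'.1.1, h1⟩)
      have h2 : p.2 ∈ V \ e₀ := Finset.mem_sdiff.2 ⟨hp'.1.2.1, hp'.2 e₀ he₀ h1⟩
      have h3 : p.swap ∈ uncovered V E := mem_uncovered.2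
        ⟨⟨hp'.1.2.1, hp'.1.1, hp'.1.2.2.symm⟩, fun e he h2 h1 => hp'.2 e he h1 h2⟩
      exact Finset.mem_union_right _ (Finset.mem_image.2 ⟨⟨p.2, p.1⟩,
        Finset.mem_sigma.2 ⟨h2, Finset.mem_sdiff.2 ⟨hN _ h3 h2, h⟩⟩, rfl⟩)
  refine (Finset.card_le_card hsub).trans ((Finset.card_union_le _ _).trans ?_)
  rw [Finset.sum_add_distrib, ← Finset.card_sigma, ← Finset.card_sigma]
  exact Nat.add_le_add Finset.card_image_le Finset.card_image_le

theorem mem_sdiff_of_mem_uncovered {p : α × α} {e : Finset α} (hp : p ∈ uncovered V E)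
    (he : e ∈ E) (h : p.1 ∈ e) : p.2 ∈ V \ e :=
  Finset.mem_sdiff.2 ⟨(mem_uncovered.1 hp).1.2.1, (mem_uncovered.1 hp).2 e he h⟩

theorem card_uncovered_le_of_card_sdiff_le (hcov : ∀ a ∈ V, ∃ e ∈ E, a ∈ e)
    (hE : ∀ e ∈ E, (V \ e).card ≤ j) : (uncovered V E).card ≤ 2 * (j * j) := by
  rcases V.eq_empty_or_nonempty with rfl | ⟨a, ha⟩
  · simp [uncovered]
  obtain ⟨e₀, he₀, -⟩ := hcov a ha
  choose! f hf hmem using hcov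
  refine (card_uncovered_le he₀ (fun a => V \ f a) fun p hp h =>
    mem_sdiff_of_mem_uncovered hp (hf _ (Finset.mem_sdiff.1 h).1)
      (hmem _ (Finset.mem_sdiff.1 h).1)).trans ?_
  calc ∑ a ∈ V \ e₀, ((V \ f a).card + ((V \ f a) \ (V \ e₀)).card)
      ≤ ∑ a ∈ V \ e₀, (j + j) := Finset.sum_le_sum fun a ha => by
        have h1 := hE _ (hf a (Finset.mem_sdiff.1 ha).1)
        exact Nat.add_le_add h1 ((Finset.card_le_card Finset.sdiff_subset).trans h1)
    _ ≤ j * (j + j) := by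
        rw [Finset.sum_const, smul_eq_mul]
        exact Nat.mul_le_mul_right _ (hE _ he₀)
    _ = 2 * (j * j) := by ring

/-- If all edge complements meet pairwise, each of the 3 vertices outside `e₀` accounts for at most
`3 + 2` ordered pairs, 15 in all. If two complements are disjoint, a third edge cuts the count to at
most 14. -/
theorem card_eq_two_of_le_card_uncovered (hcov : ∀ a ∈ V, ∃ e ∈ E, a ∈ e)
    (hsub : ∀ e ∈ E, e ⊆ V) (hE : ∀ e ∈ E, (V \ e).card = 3)
    (h16 : 16 ≤ (uncovered V E).card) : E.card = 2 := by
  by_cases h : ∃ e ∈ E, ∃ f ∈ E, Disjoint (V \ e) (V \ f)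
  · obtain ⟨e, he, f, hf, hdis⟩ := h
    have hef : e ≠ f := by
      rintro rfl
      rw [disjoint_self, Finset.bot_eq_empty] at hdis
      have := hE e he
      rw [hdis] at this
      simp at this
    rw [Finset.card_eq_two]
    refine ⟨e, f, hef, Finset.Subset.antisymm (fun g hg => ?_) ?_⟩
    · by_contra hgef
      simp only [Finset.mem_insert, Finset.mem_singleton, not_or] at hgef
      have hlt : ∀ e ∈ E, g ≠ e → ((V \ e) ∩ (V \ g)).card < 3 := by
        intro e he hge
        rw [← hE e he]
        refine Finset.card_lt_card (Finset.ssubset_iff_subset_ne.2 ⟨Finset.inter_subset_left, ?_⟩)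
        intro h
        have h1 : V \ e ⊆ V \ g := Finset.inter_eq_left.1 h
        have h2 := Finset.eq_of_subset_of_card_le h1 (by rw [hE e he, hE g hg])
        apply hge
        rw [← Finset.sdiff_sdiff_eq_self (hsub e he), h2, Finset.sdiff_sdiff_eq_self (hsub g hg)]
      have hx := hlt e he hgef.1
      have hy := hlt f hf hgef.2
      -- The disjoint complements of `e` and `f` share the 3 vertices outside `g`, and neither
      -- contains them all.
      have hxy : ((V \ e) ∩ (V \ g)).card + ((V \ f) ∩ (V \ g)).card ≤ 3 := by
        rw [← hE g hg, ← Finset.card_union_of_disjoint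
          (hdis.mono Finset.inter_subset_left Finset.inter_subset_left)]
        exact Finset.card_le_card
          (Finset.union_subset Finset.inter_subset_right Finset.inter_subset_right)
      have hle := card_uncovered_le (V := V) he
        (fun a => if a ∈ V \ g then V \ f else (V \ f) ∩ (V \ g)) (fun p hp h => by
          have h1 : p.1 ∈ V := (Finset.mem_sdiff.1 h).1
          have h2 : p.1 ∈ f := by
            by_contra h2
            exact Finset.disjoint_left.1 hdis h (Finset.mem_sdiff.2 ⟨h1, h2⟩)
          have h3 := mem_sdiff_of_mem_uncovered hp hf h2
          split_ifs with h4
          · exact h3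
          · have h5 : p.1 ∈ g := by
              by_contra h5
              exact h4 (Finset.mem_sdiff.2 ⟨h1, h5⟩)
            exact Finset.mem_inter.2 ⟨h3, mem_sdiff_of_mem_uncovered hp hg h5⟩)
      set x := ((V \ e) ∩ (V \ g)).card with hx'
      set y := ((V \ f) ∩ (V \ g)).card with hy'
      have hsum : ∑ a ∈ V \ e, ((if a ∈ V \ g then V \ f else (V \ f) ∩ (V \ g)).card +
          ((if a ∈ V \ g then V \ f else (V \ f) ∩ (V \ g)) \ (V \ e)).card) ≤
          x * 6 + (3 - x) * (2 * y) := by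
        calc _ ≤ ∑ a ∈ V \ e, (if a ∈ V \ g then 6 else 2 * y) := by
              refine Finset.sum_le_sum fun a _ => ?_
              split_ifs
              · have := Finset.card_le_card (Finset.sdiff_subset (s := V \ f) (t := V \ e))
                have := hE f hf
                omega
              · have := Finset.card_le_card
                  (Finset.sdiff_subset (s := (V \ f) ∩ (V \ g)) (t := V \ e))
                omega
          _ = _ := by
              have h1 : ((V \ e).filter fun a => a ∈ V \ g).card = x := by
                rw [Finset.filter_mem_eq_inter]
              have h2 := Finset.card_filter_add_card_filter_not (s := V \ e) (fun a => a ∈ V \ g)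
              rw [hE e he, h1] at h2
              rw [Finset.sum_ite, Finset.sum_const, Finset.sum_const, h1, smul_eq_mul, smul_eq_mul]
              congr 2
              omega
      have hle' := hle.trans hsum
      clear_value x y
      -- For `x, y ≤ 2` and `x + y ≤ 3`, the bound `6x + 2y(3-x)` is at most 14.
      interval_cases x <;> interval_cases y <;> omega
    · intro g hg
      rcases Finset.mem_insert.1 hg with rfl | hg
      · exact he
      · exact Finset.mem_singleton.1 hg ▸ hf
  · exfalso
    push Not at h
    obtain ⟨p, hp⟩ := Finset.card_pos.1 (show 0 < (uncovered V E).card by omega)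
    obtain ⟨e₀, he₀, -⟩ := hcov _ (mem_uncovered.1 hp).1.1
    choose! f hf hmem using hcov
    have hle := card_uncovered_le he₀ (fun a => V \ f a) fun p hp h =>
      mem_sdiff_of_mem_uncovered hp (hf _ (Finset.mem_sdiff.1 h).1)
        (hmem _ (Finset.mem_sdiff.1 h).1)
    have hsum : ∑ a ∈ V \ e₀, ((V \ f a).card + ((V \ f a) \ (V \ e₀)).card) ≤
        ∑ a ∈ V \ e₀, 5 := Finset.sum_le_sum fun a ha => by
      have hfa := hf a (Finset.mem_sdiff.1 ha).1
      obtain ⟨b, hb1, hb2⟩ := Finset.not_disjoint_iff.1 (h _ hfa _ he₀)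
      have h1 := hE _ hfa
      have h2 : ((V \ f a) \ (V \ e₀)).card < (V \ f a).card :=
        Finset.card_lt_card ⟨Finset.sdiff_subset, fun hs => (Finset.mem_sdiff.1 (hs hb1)).2 hb2⟩
      omega
    rw [Finset.sum_const, hE _ he₀, smul_eq_mul] at hsum
    omega

/-! ### Hypergraphs whose vertex-deleted subhypergraphs have diameter two -/

/-- The edges of a hypergraph with vertex set `V`, as finite sets. -/
noncomputable def edgeFinset (H : Hypergraph α) (V : Finset α) : Finset (Finset α) :=
  V.powerset.filter fun e => (e : Set α) ∈ H.edgeSet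

theorem mem_edgeFinset (hV : (V : Set α) = H.vertexSet) {e : Finset α} :
    e ∈ H.edgeFinset V ↔ (e : Set α) ∈ H.edgeSet := by
  rw [edgeFinset, Finset.mem_filter, Finset.mem_powerset, and_iff_right_iff_imp]
  intro he
  rw [← Finset.coe_subset, hV]
  exact H.subset_vertexSet_of_mem_edgeSet' he

theorem subset_of_mem_edgeFinset {e : Finset α} (he : e ∈ H.edgeFinset V) : e ⊆ V :=
  Finset.mem_powerset.1 (Finset.mem_filter.1 he).1

theorem IsUniform.card_of_mem_edgeFinset (hk : H.IsUniform k) {e : Finset α}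
    (he : e ∈ H.edgeFinset V) : e.card = k := by
  rw [← Set.ncard_coe_finset, hk.ncard (Finset.mem_filter.1 he).2]

theorem edgeFinset_deleteVertex (hV : (V : Set α) = H.vertexSet) (v : α) :
    (H.deleteVertex v).edgeFinset (V.erase v) = (H.edgeFinset V).filter (v ∉ ·) := by
  ext e
  rw [mem_edgeFinset (coe_erase_eq_vertexSet hV v), Finset.mem_filter, mem_edgeFinset hV]
  rfl

theorem IsUniform.exists_mem_edgeFinset (hk : H.IsUniform k) (hc : H.IsConnected)
    (hV : (V : Set α) = H.vertexSet) (h2 : 2 ≤ V.card) (hw : w ∈ V) :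
    ∃ e ∈ H.edgeFinset V, w ∈ e := by
  obtain ⟨u, hu, huw⟩ := Finset.exists_mem_ne h2 w
  rw [← Finset.mem_coe, hV] at hu hw
  obtain ⟨e, he, hwe⟩ := hc.exists_edge_mem hu hw huw
  exact ⟨(hk.finite he).toFinset, (mem_edgeFinset hV).2 (by simpa using he), by simpa using hwe⟩

theorem sum_natDist_eq_sum_offDiag (H : Hypergraph α) (V : Finset α) :
    ∑ u ∈ V, ∑ w ∈ V, H.natDist u w = ∑ p ∈ V.offDiag, H.natDist p.1 p.2 := by
  rw [← Finset.sum_product']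
  symm
  refine Finset.sum_subset (fun p hp => ?_) fun p hp hp' => ?_
  · simp only [Finset.mem_product, Finset.mem_offDiag] at hp ⊢
    exact ⟨hp.1, hp.2.1⟩
  · simp only [Finset.mem_product, Finset.mem_offDiag, not_and, not_not] at hp hp'
    rw [hp' hp.1 hp.2]
    exact natDist_self H p.2

/-- Over ordered pairs, `H` has total at least `n(n-1)`, whereas `H∖v` has diameter at most 2 and so
total at most `(n-1)(n-2)` plus the number of uncovered pairs. -/
theorem IsSoltes.le_card_uncovered (hs : H.IsSoltes) (hk : H.IsUniform k)
    (hV : (V : Set α) = H.vertexSet) (hVk : V.card ≤ 2 * k) (hv : v ∈ V) :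
    2 * (V.card - 1) ≤
      (uncovered (V.erase v) ((H.deleteVertex v).edgeFinset (V.erase v))).card := by
  have hsum := hs.sum_natDist_deleteVertex hV hv
  rw [sum_natDist_eq_sum_offDiag, sum_natDist_eq_sum_offDiag] at hsum
  have h1 : V.offDiag.card ≤ ∑ p ∈ V.offDiag, H.natDist p.1 p.2 := by
    rw [Finset.card_eq_sum_ones]
    refine Finset.sum_le_sum fun p hp => ?_
    rw [Finset.mem_offDiag] at hp
    exact hs.2.1.natDist_pos (hV ▸ hp.1) (hV ▸ hp.2.1) hp.2.2
  have h2 : ∑ p ∈ (V.erase v).offDiag, (H.deleteVertex v).natDist p.1 p.2 ≤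
      (V.erase v).offDiag.card +
        (uncovered (V.erase v) ((H.deleteVertex v).edgeFinset (V.erase v))).card := by
    rw [uncovered, Finset.card_filter, Finset.card_eq_sum_ones, ← Finset.sum_add_distrib]
    refine Finset.sum_le_sum fun p hp => ?_
    rw [Finset.mem_offDiag] at hp
    split_ifs with h
    · have := hs.natDist_deleteVertex_le hk hV hv hp.1 hp.2.1
      rwa [max_eq_left (by omega)] at this
    · push Not at h
      obtain ⟨e, he, h1, h2⟩ := h
      exact natDist_le_one ((mem_edgeFinset (coe_erase_eq_vertexSet hV v)).1 he)
        (Finset.mem_coe.2 h1) (Finset.mem_coe.2 h2)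
  rw [hsum] at h2
  have h3 := h1.trans h2
  rw [Finset.offDiag_card, Finset.offDiag_card, Finset.card_erase_of_mem hv] at h3
  obtain ⟨m, hm⟩ := Nat.exists_eq_add_of_le' (Finset.card_pos.2 ⟨v, hv⟩)
  rw [hm, Nat.succ_eq_add_one, zero_add] at h3 ⊢
  simp only [Nat.add_sub_cancel] at h3 ⊢
  have h4 : (m + 1) * (m + 1) = m * m + 2 * m + 1 := by ring
  -- Needed because the number of off-diagonal pairs is the truncated difference `m * m - m`.
  have h5 : m ≤ m * m := Nat.le_mul_self m
  omega

theorem IsUniform.card_sdiff_of_mem_edgeFinset (hk : H.IsUniform k) {e : Finset α}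
    (he : e ∈ H.edgeFinset V) : (V \ e).card = V.card - k := by
  rw [Finset.card_sdiff_of_subset (subset_of_mem_edgeFinset he), hk.card_of_mem_edgeFinset he]

theorem IsSoltes.card_sub_one_le (hs : H.IsSoltes) (hk : H.IsUniform k)
    (hV : (V : Set α) = H.vertexSet) (h3 : 3 ≤ V.card) (hVk : V.card ≤ 2 * k) :
    V.card - 1 ≤ (V.card - 1 - k) * (V.card - 1 - k) := by
  obtain ⟨v, hv⟩ := Finset.card_pos.1 (show 0 < V.card by omega)
  have hcard := Finset.card_erase_of_mem hv
  have h1 := hs.le_card_uncovered hk hV hVk hv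
  have h2 := card_uncovered_le_of_card_sdiff_le (V := V.erase v) (j := V.card - 1 - k)
    (fun w hw => (hk.deleteVertex v).exists_mem_edgeFinset (hs.isConnected_deleteVertex hV hv)
      (coe_erase_eq_vertexSet hV v) (by omega) hw)
    (fun e he => by rw [(hk.deleteVertex v).card_sdiff_of_mem_edgeFinset he, hcard])
  omega

theorem IsSoltes.not_nine_five (hs : H.IsSoltes) (hk : H.IsUniform 5)
    (hV : (V : Set α) = H.vertexSet) : V.card ≠ 9 := by
  intro h9
  have htwo : ∀ v ∈ V, ((H.edgeFinset V).filter (v ∉ ·)).card = 2 := by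
    intro v hv
    have hcard := Finset.card_erase_of_mem hv
    have h1 := hs.le_card_uncovered hk hV (by omega) hv
    rw [← edgeFinset_deleteVertex hV]
    refine card_eq_two_of_le_card_uncovered (V := V.erase v)
      (fun w hw => (hk.deleteVertex v).exists_mem_edgeFinset (hs.isConnected_deleteVertex hV hv)
        (coe_erase_eq_vertexSet hV v) (by omega) hw)
      (fun e he => subset_of_mem_edgeFinset he)
      (fun e he => by rw [(hk.deleteVertex v).card_sdiff_of_mem_edgeFinset he, hcard, h9])
      (by omega)
  -- Non-incidences: each of 9 vertices is missed by 2 edges, each edge misses 4 vertices.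
  have hcount := Finset.sum_card_bipartiteAbove_eq_sum_card_bipartiteBelow
    (s := V) (t := H.edgeFinset V) (fun v e => v ∉ e)
  have h1 : ∑ v ∈ V, (Finset.bipartiteAbove (fun v e => v ∉ e) (H.edgeFinset V) v).card = 18 := by
    rw [Finset.sum_congr rfl fun v hv => show _ = 2 by
      rw [Finset.bipartiteAbove]
      convert htwo v hv, Finset.sum_const, h9, smul_eq_mul]
  have h2 : ∑ e ∈ H.edgeFinset V, (Finset.bipartiteBelow (fun v e => v ∉ e) V e).card =
      ∑ e ∈ H.edgeFinset V, 4 := by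
    refine Finset.sum_congr rfl fun e he => ?_
    rw [Finset.bipartiteBelow, ← Finset.sdiff_eq_filter, hk.card_sdiff_of_mem_edgeFinset he, h9]
  rw [h1, h2, Finset.sum_const, smul_eq_mul] at hcount
  omega

/-! ### Range of the uniformity and the final case distinction -/

theorem IsSoltes.two_le (hs : H.IsSoltes) (hk : H.IsUniform k)
    (hV : (V : Set α) = H.vertexSet) (h2 : 2 ≤ V.card) : 2 ≤ k := by
  obtain ⟨u, hu, w, hw, huw⟩ := Finset.one_lt_card.1 h2
  rw [← Finset.mem_coe, hV] at hu hw
  obtain ⟨U, huU, hwU, hcard, -⟩ := (hs.2.1.hasWalk_natDist hu hw).exists_support hk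
  by_contra! h
  -- For `k ≤ 1` a walk never leaves its starting vertex.
  rw [show k - 1 = 0 by omega, mul_zero, zero_add] at hcard
  exact huw (Finset.card_le_one.1 hcard u huU w hwU)

theorem IsSoltes.lt_card (hs : H.IsSoltes) (hk : H.IsUniform k)
    (hV : (V : Set α) = H.vertexSet) (h3 : 3 ≤ V.card) : k < V.card := by
  obtain ⟨v, hv⟩ := Finset.card_pos.1 (show 0 < V.card by omega)
  have hcard := Finset.card_erase_of_mem hv
  obtain ⟨w, hw⟩ := Finset.card_pos.1 (show 0 < (V.erase v).card by omega)
  obtain ⟨e, he, -⟩ := (hk.deleteVertex v).exists_mem_edgeFinset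
    (hs.isConnected_deleteVertex hV hv) (coe_erase_eq_vertexSet hV v) (by omega) hw
  have h1 := Finset.card_le_card (subset_of_mem_edgeFinset he)
  rw [(hk.deleteVertex v).card_of_mem_edgeFinset he] at h1
  omega

end

end Hypergraph

theorem mainTheorem4 {α : Type*} (n k : ℕ) (hn2 : 2 ≤ n) (hn9 : n ≤ 9) (hk : (n : ℤ) - 4 ≤ (k : ℤ)) :
    ¬ ∃ H : Hypergraph α,
      H.vertexSet.encard = (n : ℕ∞) ∧ H.IsUniform k ∧ H.IsSoltes := by
  rintro ⟨H, hn, hu, hs⟩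
  have hV : ((hs.1.toFinset : Finset α) : Set α) = H.vertexSet := hs.1.coe_toFinset
  have hcard : hs.1.toFinset.card = n := by
    rw [← Set.ncard_eq_toFinset_card _ hs.1, Set.ncard, hn, ENat.toNat_natCast]
  generalize hs.1.toFinset = V at hV hcard
  subst hcard
  have hk2 : 2 ≤ k := hs.two_le hu hV hn2
  obtain rfl | hk3 := hk2.eq_or_lt
  · exact hs.not_isUniform_two hV hn2 (by omega) hu
  have h3 : 3 ≤ V.card := by
    obtain ⟨w, hw⟩ := Finset.card_pos.1 (show 0 < V.card by omega)
    obtain ⟨e, he, -⟩ := hu.exists_mem_edgeFinset hs.2.1 hV hn2 hw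
    have h1 := Finset.card_le_card (Hypergraph.subset_of_mem_edgeFinset he)
    rw [hu.card_of_mem_edgeFinset he] at h1
    omega
  have hlt := hs.lt_card hu hV h3
  rcases (show V.card = k + 4 ∨ V.card - 1 - k ≤ 2 by omega) with h4 | h4
  · obtain rfl | rfl | rfl : k = 3 ∨ k = 4 ∨ k = 5 := by omega
    · exact hs.not_seven_three hu hV h4
    · exact hs.not_eight_four hu hV h4
    · exact hs.not_nine_five hu hV h4
  -- With `j = n-1-k ≤ 2`, the bound reads `k + j ≤ j²`, impossible for `k ≥ 3`.
  · have h := hs.card_sub_one_le hu hV h3 (by omega)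
    obtain h0 | h0 | h0 : V.card - 1 - k = 0 ∨ V.card - 1 - k = 1 ∨ V.card - 1 - k = 2 := by omega
    all_goals
      rw [h0] at h
      omega
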